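/- **Setting.** Let $\mathcal K=\{1,\dots,K\}$ be a finite set of actions, and let $G_1,G_2,\dots$ be deterministic directed graphs on $\mathcal K$, each containing all self-loops; write $j\overset{t}{\to}i$ if $(j,i)$ is an arc of $G_t$. On a probability space let $p^*$ be a random probability distribution on $[0,1]^{\mathcal K}$ (with an arbitrary prior law; the coordinates under $p^*$ may be dependent) and let $\boldsymbol Y_t=(Y_{t,a})_{a\in\mathcal K}$, $t\ge 1$, be random vectors in $[0,1]^{\mathcal K}$ which, conditionally on $p^*$, are i.i.d. with law $p^*$. Let $A^*$ be a measurable function of $p^*$ with $A^*\in\arg\max_{a\in\mathcal K}\int y_a\,dp^*(y)$. In round $t$ an action $A_t\in\mathcal K$ is played and $Y_{t,a}$ is observed for every $a$ with $A_t\overset{t}{\to}a$. Let $\mathcal F_t$ be the $\sigma$-algebra generated by the actions and observations of rounds $1,\dots,t-1$ (so $\mathcal F_1$ is trivial), let $\alpha_t(a)=\mathbb P(A^*=a\mid\mathcal F_t)$, so that $\alpha_1$ is the law of $A^*$, and let $H(\alpha_1)=-\sum_{a\in\mathcal K}\alpha_1(a)\log\alpha_1(a)$ with the natural logarithm and $0\log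 0=0$. For a probability vector $\pi$ on $\mathcal K$ let $$Q_t(\pi)=\sum_{i\in\mathcal K}\frac{\pi(i)}{\sum_{j:\,j\overset{t}{\to}i}\pi(j)},\qquad \tfrac00=0 .$$ **Theorem.** Let $\epsilon\in[0,1]$ and let $T$ be a time horizon. Suppose that the actions are chosen by TS-U: for each $t\le T$, the action $A_t$ is sampled, with randomness independent of everything else given the history, from $$\boldsymbol\pi_t=(1-\epsilon)\,\alpha_t+\epsilon/K ,$$ that is, $\mathbb P(A_t=a\mid \mathcal F_t,\,p^*,\,(\boldsymbol Y_s)_{s\ge 1})=\boldsymbol\pi_t(a)$ almost surely for every $a\in\mathcal K$. Then the Bayesian regret satisfies $$\mathbb E\Big[\sum_{t=1}^T\big(Y_{t,A^*}-Y_{t,A_t}\big)\Big]\;\le\;\epsilon T+\sqrt{\tfrac12\sum_{t=1}^T\mathbb E\big[Q_t(\boldsymbol\pi_t)\big]\,H(\alpha_1)} .$$ -/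

import Mathlib

open MeasureTheory ProbabilityTheory

noncomputable section

namespace GraphBandit

/-- A vector of rewards, one in `[0,1]` for each of the `K` actions. -/
abbrev RewardVec (K : ℕ) : Type := Fin K → unitInterval

/-- The mean reward of action `a` under the reward distribution `p`. -/
def armMean {K : ℕ} (p : ProbabilityMeasure (RewardVec K)) (a : Fin K) : ℝ :=
  ∫ y, (y a : ℝ) ∂(p : Measure (RewardVec K))

/-- What is observed in one round with feedback graph `G` when action `i` is played and the
reward vector is `y`: the action `i`, and `y a` for every out-neighbour `a` of `i`.
The entries that are not observed are replaced by `0`; which entries these are is determined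
by `i`, so that nothing about `y` is disclosed by this. -/
def observation {K : ℕ} (G : Digraph (Fin K)) (i : Fin K) (y : RewardVec K) :
    Fin K × RewardVec K :=
  open Classical in (i, fun a => if G.Adj i a then y a else 0)

/-- The σ-algebra generated by the observations of all rounds before round `t`
(rounds are numbered from `0`, so the history of round `0` is trivial). -/
@[reducible]
def history {Ω : Type*} {K : ℕ} (G : ℕ → Digraph (Fin K)) (Y : ℕ → Ω → RewardVec K)
    (A : ℕ → Ω → Fin K) (t : ℕ) : MeasurableSpace Ω :=
  MeasurableSpace.comap (fun ω (s : Fin t) => observation (G s) (A s ω) (Y s ω)) inferInstance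

/-- The posterior probability, at round `t`, that the optimal action is `a`. -/
def posteriorProb {Ω : Type*} [MeasurableSpace Ω] {K : ℕ} (μ : Measure Ω)
    (G : ℕ → Digraph (Fin K)) (Astar : Ω → Fin K) (Y : ℕ → Ω → RewardVec K)
    (A : ℕ → Ω → Fin K) (t : ℕ) (a : Fin K) : Ω → ℝ :=
  μ⟦Astar ⁻¹' {a} | history G Y A t⟧

/-- The sampling distribution of Thompson sampling mixed with uniform exploration:
`π_t = (1 - ε) α_t + ε / K`. -/
def tsuPolicy {Ω : Type*} [MeasurableSpace Ω] {K : ℕ} (μ : Measure Ω)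
    (G : ℕ → Digraph (Fin K)) (Astar : Ω → Fin K) (Y : ℕ → Ω → RewardVec K)
    (A : ℕ → Ω → Fin K) (ε : ℝ) (t : ℕ) (a : Fin K) (ω : Ω) : ℝ :=
  (1 - ε) * posteriorProb μ G Astar Y A t a ω + ε / K

/-- The Bayesian stochastic bandit: `pstar` is a random reward distribution; conditionally on
`pstar` the reward vectors `Y 0, Y 1, …` are independent with common law `pstar`; and `Astar`
is an optimal action for `pstar`, chosen as a function of `pstar`. -/
structure IsBayesianBandit {Ω : Type*} [MeasurableSpace Ω] {K : ℕ} (μ : Measure Ω)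
    (pstar : Ω → ProbabilityMeasure (RewardVec K)) (Astar : Ω → Fin K)
    (Y : ℕ → Ω → RewardVec K) : Prop where
  measurable_pstar : Measurable pstar
  measurable_reward : ∀ t, Measurable (Y t)
  cond_iid : ∀ (S : Finset ℕ) (B : ℕ → Set (RewardVec K)), (∀ s, MeasurableSet (B s)) →
    μ⟦⋂ s ∈ S, Y s ⁻¹' B s | MeasurableSpace.comap pstar inferInstance⟧
      =ᵐ[μ] fun ω => ∏ s ∈ S, (pstar ω : Measure (RewardVec K)).real (B s)
  measurable_Astar : Measurable[MeasurableSpace.comap pstar inferInstance] Astar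
  optimal : ∀ ω a, armMean (pstar ω) a ≤ armMean (pstar ω) (Astar ω)

/-- In each of the rounds `0, …, T - 1` the action is drawn from the distribution `π t` with
fresh randomness: given the history, the reward distribution and all reward vectors, the
conditional probability of playing `a` in round `t` is `π t a`. -/
structure PlaysPolicy {Ω : Type*} [MeasurableSpace Ω] {K : ℕ} (μ : Measure Ω)
    (G : ℕ → Digraph (Fin K)) (pstar : Ω → ProbabilityMeasure (RewardVec K))
    (Y : ℕ → Ω → RewardVec K) (A : ℕ → Ω → Fin K) (T : ℕ) (π : ℕ → Fin K → Ω → ℝ) :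
    Prop where
  measurable_action : ∀ t, Measurable (A t)
  sampling : ∀ t < T, ∀ a,
    μ⟦A t ⁻¹' {a} | history G Y A t ⊔ MeasurableSpace.comap pstar inferInstance
        ⊔ MeasurableSpace.comap (fun ω s => Y s ω) inferInstance⟧ =ᵐ[μ] π t a

/-- The Bayesian regret over the rounds `0, …, T - 1`. -/
def bayesRegret {Ω : Type*} [MeasurableSpace Ω] {K : ℕ} (μ : Measure Ω) (Astar : Ω → Fin K)
    (Y : ℕ → Ω → RewardVec K) (A : ℕ → Ω → Fin K) (T : ℕ) : ℝ :=
  ∫ ω, ∑ t ∈ Finset.range T, ((Y t ω (Astar ω) : ℝ) - (Y t ω (A t ω) : ℝ)) ∂μ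

/-- `Q(p) = ∑_i p(i) / ∑_{j → i} p(j)`, with the convention `0 / 0 = 0`. -/
def graphQ {K : ℕ} (G : Digraph (Fin K)) (p : Fin K → ℝ) : ℝ :=
  open Classical in ∑ i, p i / ∑ j with G.Adj j i, p j

/-- Shannon entropy (natural logarithm, `0 log 0 = 0`). -/
def shannonEntropy {K : ℕ} (p : Fin K → ℝ) : ℝ :=
  -∑ i, p i * Real.log (p i)

/-- The prior distribution of the optimal action. -/
def prior {Ω : Type*} [MeasurableSpace Ω] {K : ℕ} (μ : Measure Ω) (Astar : Ω → Fin K)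
    (a : Fin K) : ℝ :=
  μ.real (Astar ⁻¹' {a})

end GraphBandit

end

/-! Write `M`, `q`, `h` for the posterior probability that `a` is optimal, the probability of
observing `a`, and the posterior mean of its reward; let `d` be the mean of that reward given that
`a` is optimal, minus `h`. Since `π ≥ (1 - ε) M` and rewards are nonnegative, a round costs at most
`ε + ∑ (1 - ε) E[M d]` (`integral_round_regret_le`). Self-loops give `π ≤ q`, so AM-GM with a free
weight `c` bounds each term by `c/2 · π/q + M q d² / (2c)` (`mul_gap_le`). The quotients `π/q` sum
to `Q`.

The squares are paid for by entropy, one event `Astar = a` at a time: a round raises `E[M log M]` by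
at least `2 E[M q d²]` (`integral_mul_log_condExp_add_le`). This is Pinsker's inequality in
variational form: `x log x` is tested against an exponential tilt of the observed reward, whose
exponential moment Hoeffding's lemma controls. Summed over actions, `E[M log M]` starts at minus the
prior entropy and stays nonpositive, so the squares total at most half that entropy. Optimising `c`
gives the square root. -/

/-! ### Real inequalities. -/

/-- Hoeffding's bound for the exponential moment of a Bernoulli variable. -/
theorem Real.one_sub_add_mul_exp_le {h : ℝ} (h0 : 0 ≤ h) (h1 : h ≤ 1) (l : ℝ) :
    1 - h + h * Real.exp l ≤ Real.exp (l * h + l ^ 2 / 8) := by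
  let ν : Measure ℝ := ENNReal.ofReal h • Measure.dirac 1 + ENNReal.ofReal (1 - h) • Measure.dirac 0
  have hν : IsProbabilityMeasure ν := ⟨by
    simp only [ν, Measure.add_apply, Measure.smul_apply, measure_univ, smul_eq_mul, mul_one]
    rw [← ENNReal.ofReal_add h0 (by linarith)]; simp⟩
  have hint : ∀ g : ℝ → ℝ, Measurable g → ∫ x, g x ∂ν = h * g 1 + (1 - h) * g 0 := by
    intro g hg
    have hi : ∀ x : ℝ, Integrable g (Measure.dirac x) := fun x =>
      integrable_dirac (by simp)
    rw [integral_add_measure ((hi 1).smul_measure (by simp)) ((hi 0).smul_measure (by simp)),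
      integral_smul_measure, integral_smul_measure, integral_dirac, integral_dirac,
      ENNReal.toReal_ofReal h0, ENNReal.toReal_ofReal (by linarith)]
    simp
  have hae : ∀ᵐ x ∂ν, (id x : ℝ) ∈ Set.Icc (0 : ℝ) 1 := by
    simp only [ν, ae_add_measure_iff]
    refine ⟨Measure.ae_smul_measure ?_ _, Measure.ae_smul_measure ?_ _⟩ <;> simp [ae_dirac_eq]
  -- An interval of length 1 has variance proxy 1/4, whence the exponent `l ^ 2 / 8` after centring
  -- at `h`.
  have key := (hasSubgaussianMGF_of_mem_Icc (μ := ν) measurable_id.aemeasurable hae).mgf_le l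
  have hmean : ∫ x, (id x : ℝ) ∂ν = h := by rw [hint _ measurable_id]; simp
  rw [hmean, mgf, hint _ (by fun_prop)] at key
  have e1 : Real.exp (l * (1 - h)) = Real.exp l * Real.exp (-(l * h)) := by
    rw [← Real.exp_add]; ring_nf
  have e2 : Real.exp (l * (0 - h)) = Real.exp (-(l * h)) := by ring_nf
  simp only [id, e1, e2] at key
  have hm := mul_le_mul_of_nonneg_left key (Real.exp_pos (l * h)).le
  have e3 : Real.exp (l * h) * Real.exp (-(l * h)) = 1 := by rw [← Real.exp_add]; simp
  have hl : Real.exp (l * h) * (h * (Real.exp l * Real.exp (-(l * h)))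
      + (1 - h) * Real.exp (-(l * h))) = 1 - h + h * Real.exp l := by
    linear_combination (h * Real.exp l + (1 - h)) * e3
  rw [hl, ← Real.exp_add] at hm
  refine hm.trans (le_of_eq ?_)
  congr 2
  norm_num
  ring

/-- The exponential of a linear function on `[0, 1]` lies below its chord. -/
theorem Real.exp_mul_le_chord {y : ℝ} (h0 : 0 ≤ y) (h1 : y ≤ 1) (l : ℝ) :
    Real.exp (l * y) ≤ 1 - y + y * Real.exp l := by
  have := convexOn_exp.2 (Set.mem_univ (0 : ℝ)) (Set.mem_univ l) (sub_nonneg.2 h1) h0 (by ring)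
  simpa [mul_comm] using this

/-- Young's inequality for the pair `x log x`, `exp`. -/
theorem Real.mul_add_sub_mul_exp_le {x m : ℝ} (hx : 0 ≤ x) (hm : 0 < m) (f : ℝ) :
    x * Real.log m + x * f + x - m * Real.exp f ≤ x * Real.log x := by
  rcases hx.eq_or_lt with rfl | hx
  · simp; positivity
  have h := Real.log_le_sub_one_of_pos (x := m * Real.exp f / x) (by positivity)
  rw [Real.log_div (by positivity) hx.ne', Real.log_mul hm.ne' (Real.exp_pos f).ne',
    Real.log_exp] at h
  have := mul_le_mul_of_nonneg_left h hx.le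
  have e : x * (m * Real.exp f / x - 1) = m * Real.exp f - x := by field_simp
  rw [e] at this
  linarith

/-- Optimising the weight in a weighted arithmetic-geometric mean inequality. -/
theorem Real.le_sqrt_mul_of_forall_pos {x a b : ℝ} (ha : 0 ≤ a) (hb : 0 ≤ b)
    (h : ∀ c > 0, x ≤ c / 2 * a + 1 / (2 * c) * b) : x ≤ Real.sqrt (a * b) := by
  -- The best weight is `√b / √a`; shifting both by `δ` keeps it positive and finite when `a` or `b`
  -- vanishes.
  have key : ∀ δ > 0, x ≤ Real.sqrt ((a + δ) * (b + δ)) := by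
    intro δ hδ
    have hu : 0 < Real.sqrt (a + δ) := Real.sqrt_pos.2 (by linarith)
    have hv : 0 < Real.sqrt (b + δ) := Real.sqrt_pos.2 (by linarith)
    have hu2 := Real.sq_sqrt (show 0 ≤ a + δ by linarith)
    have hv2 := Real.sq_sqrt (show 0 ≤ b + δ by linarith)
    rw [Real.sqrt_mul (by linarith)]
    set u := Real.sqrt (a + δ)
    set v := Real.sqrt (b + δ)
    have h1 := h (v / u) (by positivity)
    have h2 : v / u / 2 * a ≤ v / u / 2 * u ^ 2 := by gcongr; linarith
    have h3 : 1 / (2 * (v / u)) * b ≤ 1 / (2 * (v / u)) * v ^ 2 := by gcongr; linarith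
    have h4 : v / u / 2 * u ^ 2 + 1 / (2 * (v / u)) * v ^ 2 = u * v := by field_simp; ring
    linarith
  have hc : Filter.Tendsto (fun δ => Real.sqrt ((a + δ) * (b + δ))) (nhdsWithin 0 (Set.Ioi 0))
      (nhds (Real.sqrt ((a + 0) * (b + 0)))) :=
    (Continuous.tendsto (by fun_prop) 0).mono_left nhdsWithin_le_nhds
  simp only [add_zero] at hc
  exact ge_of_tendsto hc (Filter.eventually_of_mem self_mem_nhdsWithin key)

/-! ### Bounded functions measurable for a sub-σ-algebra. -/

theorem condExp_mem_Icc {Ω : Type*} {m m0 : MeasurableSpace Ω} {μ : Measure Ω}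
    [IsFiniteMeasure μ] (hm : m ≤ m0) {a b : ℝ} {f : Ω → ℝ}
    (hf : Integrable f μ) (h : ∀ ω, f ω ∈ Set.Icc a b) :
    ∀ᵐ ω ∂μ, (μ[f | m]) ω ∈ Set.Icc a b := by
  have h1 := condExp_mono (m := m) (integrable_const (μ := μ) a) hf
    (Filter.Eventually.of_forall fun ω => (h ω).1)
  have h2 := condExp_mono (m := m) hf (integrable_const (μ := μ) b)
    (Filter.Eventually.of_forall fun ω => (h ω).2)
  rw [condExp_const hm] at h1 h2
  filter_upwards [h1, h2] with ω w1 w2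
  exact ⟨w1, w2⟩

/-- `f` is almost everywhere bounded and equal to an `m`-measurable function. -/
structure BddMeas {Ω : Type*} (m : MeasurableSpace Ω) [MeasurableSpace Ω] (μ : Measure Ω)
    (f : Ω → ℝ) : Prop where
  meas : AEStronglyMeasurable[m] f μ
  bdd : ∃ C, ∀ᵐ ω ∂μ, |f ω| ≤ C

namespace BddMeas

variable {Ω : Type*} {m m' : MeasurableSpace Ω} [m0 : MeasurableSpace Ω] {μ : Measure Ω}
  {f g : Ω → ℝ}

theorem mono (hf : BddMeas m μ f) (h : m ≤ m') : BddMeas m' μ f :=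
  ⟨hf.meas.mono h, hf.bdd⟩

theorem const (c : ℝ) : BddMeas m μ (fun _ => c) :=
  ⟨aestronglyMeasurable_const, |c|, by simp⟩

theorem add (hf : BddMeas m μ f) (hg : BddMeas m μ g) : BddMeas m μ (fun ω => f ω + g ω) := by
  refine ⟨hf.meas.add hg.meas, ?_⟩
  obtain ⟨C, hC⟩ := hf.bdd
  obtain ⟨D, hD⟩ := hg.bdd
  refine ⟨C + D, ?_⟩
  filter_upwards [hC, hD] with ω h1 h2
  exact (abs_add_le _ _).trans (add_le_add h1 h2)

theorem mul (hf : BddMeas m μ f) (hg : BddMeas m μ g) : BddMeas m μ (fun ω => f ω * g ω) := by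
  refine ⟨hf.meas.mul hg.meas, ?_⟩
  obtain ⟨C, hC⟩ := hf.bdd
  obtain ⟨D, hD⟩ := hg.bdd
  refine ⟨C * D, ?_⟩
  filter_upwards [hC, hD] with ω h1 h2
  rw [abs_mul]
  exact mul_le_mul h1 h2 (abs_nonneg _) ((abs_nonneg _).trans h1)

theorem neg (hf : BddMeas m μ f) : BddMeas m μ (fun ω => -f ω) := by
  simpa using (const (-1)).mul hf

theorem sub (hf : BddMeas m μ f) (hg : BddMeas m μ g) : BddMeas m μ (fun ω => f ω - g ω) := by
  simpa [sub_eq_add_neg] using hf.add hg.neg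

theorem sum {ι : Type*} (s : Finset ι) {F : ι → Ω → ℝ} (hF : ∀ i ∈ s, BddMeas m μ (F i)) :
    BddMeas m μ (fun ω => ∑ i ∈ s, F i ω) := by
  classical
  induction s using Finset.induction_on with
  | empty => simpa using const 0
  | insert a s ha ih =>
    simp only [Finset.sum_insert ha]
    exact (hF a (by simp)).add (ih fun i hi => hF i (by simp [hi]))

theorem exp (hf : BddMeas m μ f) : BddMeas m μ (fun ω => Real.exp (f ω)) := by
  refine ⟨Real.continuous_exp.comp_aestronglyMeasurable hf.meas, ?_⟩
  obtain ⟨C, hC⟩ := hf.bdd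
  refine ⟨Real.exp C, ?_⟩
  filter_upwards [hC] with ω h1
  rw [Real.abs_exp]
  exact Real.exp_le_exp.2 ((le_abs_self _).trans h1)

theorem mul_log (hf : BddMeas m μ f) : BddMeas m μ (fun ω => f ω * Real.log (f ω)) := by
  refine ⟨Real.continuous_mul_log.comp_aestronglyMeasurable hf.meas, ?_⟩
  obtain ⟨C, hC⟩ := hf.bdd
  obtain ⟨D, hD⟩ := (isCompact_Icc (a := -C) (b := C)).exists_bound_of_continuousOn
    Real.continuous_mul_log.continuousOn
  refine ⟨D, ?_⟩
  filter_upwards [hC] with ω h1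
  exact hD _ (abs_le.1 h1)

theorem log_add {δ : ℝ} (hδ : 0 < δ) (hf : BddMeas m μ f) (h0 : 0 ≤ᵐ[μ] f) :
    BddMeas m μ (fun ω => Real.log (f ω + δ)) := by
  obtain ⟨f', hf', hff'⟩ := hf.meas
  refine ⟨⟨fun ω => Real.log (f' ω + δ),
    (Real.measurable_log.comp (hf'.measurable.add_const δ)).stronglyMeasurable, ?_⟩, ?_⟩
  · filter_upwards [hff'] with ω hω
    rw [hω]
  obtain ⟨C, hC⟩ := hf.bdd
  refine ⟨|Real.log δ| + |Real.log (C + δ)|, ?_⟩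
  filter_upwards [hC, h0] with ω h1 h2
  have h2 : 0 ≤ f ω := h2
  have h3 := Real.log_le_log hδ (show δ ≤ f ω + δ by linarith)
  have h4 := Real.log_le_log (show 0 < f ω + δ by linarith)
    (show f ω + δ ≤ C + δ by linarith [(le_abs_self _).trans h1])
  rw [abs_le]
  constructor
  · linarith [neg_abs_le (Real.log δ), abs_nonneg (Real.log (C + δ))]
  · linarith [le_abs_self (Real.log (C + δ)), abs_nonneg (Real.log δ)]

theorem of_mem_Icc (hf : AEStronglyMeasurable[m] f μ) {a b : ℝ}
    (h : ∀ᵐ ω ∂μ, f ω ∈ Set.Icc a b) : BddMeas m μ f := by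
  refine ⟨hf, max |a| |b|, ?_⟩
  filter_upwards [h] with ω hω
  exact abs_le_max_abs_abs hω.1 hω.2

theorem div_of_mem_Icc {a b : ℝ} (hf : BddMeas m μ f) (hg : BddMeas m μ g)
    (h : ∀ᵐ ω ∂μ, f ω / g ω ∈ Set.Icc a b) : BddMeas m μ (fun ω => f ω / g ω) := by
  refine of_mem_Icc ?_ h
  obtain ⟨f', hf', hff'⟩ := hf.meas
  obtain ⟨g', hg', hgg'⟩ := hg.meas
  refine ⟨fun ω => f' ω / g' ω, (hf'.measurable.div hg'.measurable).stronglyMeasurable, ?_⟩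
  filter_upwards [hff', hgg'] with ω h1 h2
  rw [h1, h2]

theorem condExp_of_mem_Icc (hm : m ≤ m0) [IsFiniteMeasure μ] {a b : ℝ} (hf : Integrable f μ)
    (h : ∀ ω, f ω ∈ Set.Icc a b) : BddMeas m μ (μ[f | m]) :=
  of_mem_Icc stronglyMeasurable_condExp.aestronglyMeasurable (condExp_mem_Icc hm hf h)

theorem integrable [IsFiniteMeasure μ] (hf : BddMeas m μ f) (hm : m ≤ m0) : Integrable f μ := by
  obtain ⟨C, hC⟩ := hf.bdd
  exact Integrable.of_bound (hf.meas.mono hm) C hC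

/-- The conditional expectation is self-adjoint against bounded functions. -/
theorem integral_condExp_mul [IsFiniteMeasure μ] (hm : m ≤ m0) (hf : Integrable f μ)
    (hg : BddMeas m μ g) : ∫ ω, (μ[f | m]) ω * g ω ∂μ = ∫ ω, f ω * g ω ∂μ := by
  obtain ⟨C, hC⟩ := hg.bdd
  have hi : Integrable (f * g) μ := hf.mul_bdd (hg.meas.mono hm) hC
  rw [← integral_condExp hm (f := fun ω => f ω * g ω)]
  exact integral_congr_ae (condExp_mul_of_aestronglyMeasurable_right hg.meas hi hf).symm

end BddMeas

/-! ### Entropy reduction from one randomly revealed variable. -/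

section InformationGain

variable {Ω : Type*} {m m' 𝒢 : MeasurableSpace Ω} [m0 : MeasurableSpace Ω] {μ : Measure Ω}

/-- The difference between the conditional mean of `y` under the weight `s` and its
unweighted conditional mean. -/
noncomputable def condMeanGap (μ : Measure Ω) (m : MeasurableSpace Ω) (s y : Ω → ℝ) (ω : Ω) : ℝ :=
  (μ[fun ω => s ω * y ω | m]) ω / (μ[s | m]) ω - (μ[y | m]) ω

/-- The upper bound forces the numerator in `condMeanGap` to vanish with its denominator, which
makes the value `0 / 0 = 0` harmless. -/
theorem condExp_mul_mem_Icc [IsProbabilityMeasure μ] {s y : Ω → ℝ} (hs : BddMeas m0 μ s)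
    (hs01 : ∀ ω, s ω ∈ Set.Icc (0 : ℝ) 1) (hy : BddMeas m0 μ y)
    (hy01 : ∀ ω, y ω ∈ Set.Icc (0 : ℝ) 1) :
    ∀ᵐ ω ∂μ, (μ[fun ω => s ω * y ω | m]) ω ∈ Set.Icc 0 ((μ[s | m]) ω) := by
  have hi := (hs.mul hy).integrable le_rfl
  have h1 := condExp_nonneg (m := m) (μ := μ) (f := fun ω => s ω * y ω)
    (Filter.Eventually.of_forall fun ω => mul_nonneg (hs01 ω).1 (hy01 ω).1)
  have h2 := condExp_mono (m := m) hi (hs.integrable le_rfl)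
    (Filter.Eventually.of_forall fun ω => mul_le_of_le_one_right (hs01 ω).1 (hy01 ω).2)
  filter_upwards [h1, h2] with ω w1 w2
  exact ⟨w1, w2⟩

theorem condExp_mul_condMeanGap [IsProbabilityMeasure μ] {s y : Ω → ℝ} (hs : BddMeas m0 μ s)
    (hs01 : ∀ ω, s ω ∈ Set.Icc (0 : ℝ) 1) (hy : BddMeas m0 μ y)
    (hy01 : ∀ ω, y ω ∈ Set.Icc (0 : ℝ) 1) :
    ∀ᵐ ω ∂μ, (μ[s | m]) ω * condMeanGap μ m s y ω
      = (μ[fun ω => s ω * y ω | m]) ω - (μ[s | m]) ω * (μ[y | m]) ω := by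
  filter_upwards [condExp_mul_mem_Icc hs hs01 hy hy01] with ω hN
  simp only [condMeanGap]
  rcases eq_or_ne ((μ[s | m]) ω) 0 with h0 | h0
  · rw [h0] at hN ⊢
    linarith [hN.1, hN.2]
  · field_simp

theorem bddMeas_condMeanGap [IsProbabilityMeasure μ] (hm : m ≤ m0) {s y : Ω → ℝ} (hs : BddMeas m0 μ s)
    (hs01 : ∀ ω, s ω ∈ Set.Icc (0 : ℝ) 1) (hy : BddMeas m0 μ y)
    (hy01 : ∀ ω, y ω ∈ Set.Icc (0 : ℝ) 1) :
    BddMeas m μ (condMeanGap μ m s y) := by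
  have hsy01 : ∀ ω, s ω * y ω ∈ Set.Icc (0 : ℝ) 1 := fun ω =>
    ⟨mul_nonneg (hs01 ω).1 (hy01 ω).1, mul_le_one₀ (hs01 ω).2 (hy01 ω).1 (hy01 ω).2⟩
  have hM := BddMeas.condExp_of_mem_Icc hm (hs.integrable le_rfl) hs01
  have hN := BddMeas.condExp_of_mem_Icc hm ((hs.mul hy).integrable le_rfl) hsy01
  have hh := BddMeas.condExp_of_mem_Icc hm (hy.integrable le_rfl) hy01
  refine BddMeas.sub (hN.div_of_mem_Icc hM (a := 0) (b := 1) ?_) hh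
  filter_upwards [condExp_mul_mem_Icc hs hs01 hy hy01] with ω h
  exact ⟨div_nonneg h.1 (h.1.trans h.2), div_le_one_of_le₀ h.2 (h.1.trans h.2)⟩

/-- If `y` is revealed on the event with indicator `b`, which has conditional probability `q`
and is conditionally independent of `(s, y)`, then the expected entropy reduction of `s` is at
least twice the expected square of the gap between the conditional means of `y`. -/
theorem integral_mul_log_condExp_add_le [IsProbabilityMeasure μ] (hmm' : m ≤ m') (hm' : m' ≤ m0)
    (hmG : m ≤ 𝒢) (hG : 𝒢 ≤ m0) {s y b q : Ω → ℝ}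
    (hs : BddMeas 𝒢 μ s) (hs01 : ∀ ω, s ω ∈ Set.Icc (0 : ℝ) 1)
    (hy : BddMeas 𝒢 μ y) (hy01 : ∀ ω, y ω ∈ Set.Icc (0 : ℝ) 1)
    (hb : BddMeas m' μ b) (hb01 : ∀ ω, b ω = 0 ∨ b ω = 1)
    (hby : BddMeas m' μ (fun ω => b ω * y ω))
    (hq : BddMeas m μ q) (hbq : μ[b | 𝒢] =ᵐ[μ] q) :
    2 * ∫ ω, (μ[s | m]) ω * q ω * condMeanGap μ m s y ω ^ 2 ∂μ
      + ∫ ω, (μ[s | m]) ω * Real.log ((μ[s | m]) ω) ∂μ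
      ≤ ∫ ω, (μ[s | m']) ω * Real.log ((μ[s | m']) ω) ∂μ := by
  have hm : m ≤ m0 := hmm'.trans hm'
  have hs0 := hs.mono hG
  have hy0 := hy.mono hG
  have hb0 := hb.mono hm'
  have hsi := hs0.integrable le_rfl
  have hyi := hy0.integrable le_rfl
  have hbi := hb0.integrable le_rfl
  have hMI := condExp_mem_Icc hm hsi hs01
  have hM'I := condExp_mem_Icc hm' hsi hs01
  have hhI := condExp_mem_Icc hm hyi hy01
  have hM := BddMeas.condExp_of_mem_Icc hm hsi hs01
  have hM' := BddMeas.condExp_of_mem_Icc hm' hsi hs01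
  have hh := BddMeas.condExp_of_mem_Icc hm hyi hy01
  have hd := bddMeas_condMeanGap hm hs0 hs01 hy0 hy01
  have hMd := condExp_mul_condMeanGap (m := m) hs0 hs01 hy0 hy01
  have pullM : ∀ {Z : Ω → ℝ}, BddMeas m μ Z → ∫ ω, s ω * Z ω ∂μ = ∫ ω, (μ[s | m]) ω * Z ω ∂μ :=
    fun hZ => (BddMeas.integral_condExp_mul hm hsi hZ).symm
  have pullN : ∀ {Z : Ω → ℝ}, BddMeas m μ Z → ∫ ω, s ω * y ω * Z ω ∂μ
      = ∫ ω, (μ[fun ω => s ω * y ω | m]) ω * Z ω ∂μ :=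
    fun hZ => (BddMeas.integral_condExp_mul hm ((hs0.mul hy0).integrable le_rfl) hZ).symm
  have pullh : ∀ {Z : Ω → ℝ}, BddMeas m μ Z → ∫ ω, y ω * Z ω ∂μ = ∫ ω, (μ[y | m]) ω * Z ω ∂μ :=
    fun hZ => (BddMeas.integral_condExp_mul hm hyi hZ).symm
  -- Conditional independence enters here: `Z` may involve `s` and `y`, yet `b` is replaced by the
  -- `m`-measurable `q`.
  have pullb : ∀ {Z : Ω → ℝ}, BddMeas 𝒢 μ Z → ∫ ω, b ω * Z ω ∂μ = ∫ ω, q ω * Z ω ∂μ := by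
    intro Z hZ
    rw [← BddMeas.integral_condExp_mul hG hbi hZ]
    refine integral_congr_ae ?_
    filter_upwards [hbq] with ω hω
    rw [hω]
  have hq0 : 0 ≤ᵐ[μ] q := by
    refine (condExp_nonneg (m := 𝒢) (μ := μ) (f := b) (Filter.Eventually.of_forall fun ω => ?_)).trans
      hbq.le
    rcases hb01 ω with h | h <;> simp [h]
  set M := μ[s | m]
  set M' := μ[s | m']
  set h := μ[y | m]
  set N := μ[fun ω => s ω * y ω | m]
  set d := condMeanGap μ m s y
  have hl : BddMeas m μ (fun ω => 4 * d ω) := (BddMeas.const 4).mul hd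
  have hk : BddMeas m μ (fun ω => 4 * d ω * h ω + 2 * (d ω * d ω)) :=
    (hl.mul hh).add ((BddMeas.const 2).mul (hd.mul hd))
  -- This is `b * (l * (y - h) - l ^ 2 / 8)` with `l = 4 * d`, the maximiser of `l * d - l ^ 2 / 8`;
  -- the maximum is `2 * d ^ 2`. The reward enters only through `b * y`, so `f` is `m'`-measurable.
  let f : Ω → ℝ := fun ω => 4 * d ω * (b ω * y ω) - (4 * d ω * h ω + 2 * (d ω * d ω)) * b ω
  have hf : BddMeas m' μ f := ((hl.mono hmm').mul hby).sub ((hk.mono hmm').mul hb)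
  have hNi : Integrable (fun ω => N ω * (q ω * (4 * d ω))) μ :=
    (BddMeas.condExp_of_mem_Icc hm ((hs0.mul hy0).integrable le_rfl) (a := 0) (b := 1)
      (fun ω => ⟨mul_nonneg (hs01 ω).1 (hy01 ω).1, mul_le_one₀ (hs01 ω).2 (hy01 ω).1 (hy01 ω).2⟩)
      |>.mul (hq.mul hl)).integrable hm
  have tilt : ∫ ω, s ω * f ω ∂μ = 2 * ∫ ω, M ω * q ω * d ω ^ 2 ∂μ := by
    have e1 : ∀ ω, s ω * f ω
        = b ω * (s ω * y ω * (4 * d ω) - s ω * (4 * d ω * h ω + 2 * (d ω * d ω))) := by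
      intro ω; simp only [f]; ring
    have e2 : ∀ ω, q ω * (s ω * y ω * (4 * d ω) - s ω * (4 * d ω * h ω + 2 * (d ω * d ω)))
        = s ω * y ω * (q ω * (4 * d ω))
          - s ω * (q ω * (4 * d ω * h ω + 2 * (d ω * d ω))) := by intro ω; ring
    simp_rw [e1]
    rw [pullb (((hs.mul hy).mul (hl.mono hmG)).sub (hs.mul (hk.mono hmG)))]
    simp_rw [e2]
    rw [integral_sub (((hs0.mul hy0).mul ((hq.mul hl).mono hm)).integrable le_rfl)
      ((hs0.mul ((hq.mul hk).mono hm)).integrable le_rfl), pullN (hq.mul hl), pullM (hq.mul hk),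
      ← integral_sub hNi ((hM.mul (hq.mul hk)).integrable hm), ← integral_const_mul]
    refine integral_congr_ae ?_
    filter_upwards [hMd] with ω hω
    linear_combination (-4 * q ω * d ω) * hω
  have expBound : ∀ δ > 0, ∫ ω, (M ω + δ) * Real.exp (f ω) ∂μ ≤ ∫ ω, M ω + δ ∂μ := by
    intro δ hδ
    have hMδ : BddMeas m μ (fun ω => M ω + δ) := hM.add (BddMeas.const δ)
    let g : Ω → ℝ := fun ω => Real.exp (-(4 * d ω * h ω + 2 * (d ω * d ω)))
    have hg : BddMeas m μ g := hk.neg.exp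
    have hgl : BddMeas m μ (fun ω => g ω * (Real.exp (4 * d ω) - 1)) :=
      hg.mul (hl.exp.sub (BddMeas.const 1))
    have hg1 : BddMeas m μ (fun ω => g ω - 1) := hg.sub (BddMeas.const 1)
    have hW : BddMeas 𝒢 μ (fun ω => (M ω + δ) * (y ω * (g ω * (Real.exp (4 * d ω) - 1)) + (g ω - 1))) :=
      (hMδ.mono hmG).mul ((hy.mul (hgl.mono hmG)).add (hg1.mono hmG))
    -- The chord makes the bound affine in `y`, so conditioning needs only the mean `h` and no
    -- conditional law of `y`.
    have le1 : ∀ᵐ ω ∂μ, (M ω + δ) * Real.exp (f ω) ≤ (M ω + δ)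
        + b ω * ((M ω + δ) * (y ω * (g ω * (Real.exp (4 * d ω) - 1)) + (g ω - 1))) := by
      filter_upwards [hMI] with ω hMω
      rcases hb01 ω with hbω | hbω
      · simp [f, hbω]
      · have hchord := Real.exp_mul_le_chord (hy01 ω).1 (hy01 ω).2 (4 * d ω)
        have e : Real.exp (f ω) = g ω * Real.exp (4 * d ω * y ω) := by
          simp only [f, g, hbω, ← Real.exp_add]
          congr 1; ring
        have hgp : 0 < g ω := Real.exp_pos _
        have := mul_le_mul_of_nonneg_left (mul_le_mul_of_nonneg_left hchord hgp.le)
          (show 0 ≤ M ω + δ by linarith [hMω.1])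
        rw [e, hbω]
        refine this.trans (le_of_eq ?_)
        ring
    have iMδ := hMδ.integrable hm
    refine (integral_mono_ae (((hMδ.mono hmm').mul hf.exp).integrable hm')
      (iMδ.add ((hb0.mul (hW.mono hG)).integrable le_rfl)) le1).trans ?_
    rw [integral_add' iMδ ((hb0.mul (hW.mono hG)).integrable le_rfl), pullb hW]
    have e2 : ∀ ω, q ω * ((M ω + δ) * (y ω * (g ω * (Real.exp (4 * d ω) - 1)) + (g ω - 1)))
        = y ω * (q ω * ((M ω + δ) * (g ω * (Real.exp (4 * d ω) - 1))))
          + q ω * ((M ω + δ) * (g ω - 1)) := by intro ω; ring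
    have hV := hq.mul (hMδ.mul hgl)
    have hV1 := hq.mul (hMδ.mul hg1)
    simp_rw [e2]
    rw [integral_add ((hy0.mul (hV.mono hm)).integrable le_rfl) (hV1.integrable hm), pullh hV,
      ← integral_add ((hh.mul hV).integrable hm) (hV1.integrable hm)]
    have : ∫ ω, h ω * (q ω * ((M ω + δ) * (g ω * (Real.exp (4 * d ω) - 1))))
          + q ω * ((M ω + δ) * (g ω - 1)) ∂μ ≤ 0 := by
      refine integral_nonpos_of_ae ?_
      filter_upwards [hMI, hhI, hq0] with ω hMω hhω hqω
      have hgp : 0 < g ω := Real.exp_pos _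
      have hhoef := mul_le_mul_of_nonneg_left
        (Real.one_sub_add_mul_exp_le hhω.1 hhω.2 (4 * d ω)) hgp.le
      -- The subtracted `2 * d ^ 2` in `f` cancels the Hoeffding term `(4 * d) ^ 2 / 8` exactly.
      have e3 : g ω * Real.exp (4 * d ω * h ω + (4 * d ω) ^ 2 / 8) = 1 := by
        simp only [g, ← Real.exp_add]
        rw [Real.exp_eq_one_iff]; ring
      rw [e3] at hhoef
      have hfac : 0 ≤ q ω * (M ω + δ) := mul_nonneg hqω (by linarith [hMω.1])
      have := mul_nonneg hfac (sub_nonneg.2 hhoef)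
      simp only [Pi.zero_apply]
      linarith
    linarith
  -- `M` may approach 0, where its logarithm is unbounded; using `M + δ` as reference costs only `δ`
  -- in the end.
  refine le_of_forall_pos_le_add fun δ hδ => ?_
  have hMδ : BddMeas m μ (fun ω => M ω + δ) := hM.add (BddMeas.const δ)
  have hL : BddMeas m μ (fun ω => Real.log (M ω + δ)) :=
    hM.log_add hδ (by filter_upwards [hMI] with ω hω using hω.1)
  have hL1 : BddMeas m μ (fun ω => Real.log (M ω + δ) + 1) := hL.add (BddMeas.const 1)
  have hL1f : BddMeas m' μ (fun ω => (Real.log (M ω + δ) + 1) + f ω) := (hL1.mono hmm').add hf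
  -- The variational lower bound for relative entropy, with test function `f` and reference `M + δ`.
  have young : ∫ ω, M' ω * ((Real.log (M ω + δ) + 1) + f ω) - (M ω + δ) * Real.exp (f ω) ∂μ
      ≤ ∫ ω, M' ω * Real.log (M' ω) ∂μ := by
    refine integral_mono_ae (((hM'.mul hL1f).sub ((hMδ.mono hmm').mul hf.exp)).integrable hm')
      (hM'.mul_log.integrable hm') ?_
    filter_upwards [hM'I, hMI] with ω hω hω2
    have := Real.mul_add_sub_mul_exp_le hω.1 (show 0 < M ω + δ by linarith [hω2.1]) (f ω)
    linarith
  rw [integral_sub ((hM'.mul hL1f).integrable hm') (((hMδ.mono hmm').mul hf.exp).integrable hm'),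
    BddMeas.integral_condExp_mul hm' hsi hL1f] at young
  have iL1 := (hs0.mul (hL1.mono hm)).integrable le_rfl
  have split : ∫ ω, s ω * ((Real.log (M ω + δ) + 1) + f ω) ∂μ
      = ∫ ω, s ω * (Real.log (M ω + δ) + 1) ∂μ + ∫ ω, s ω * f ω ∂μ := by
    rw [← integral_add iL1 ((hs0.mul (hf.mono hm')).integrable le_rfl)]
    simp_rw [mul_add]
  rw [split, pullM hL1, tilt] at young
  have low : ∫ ω, M ω * Real.log (M ω) ∂μ + ∫ ω, M ω ∂μ
      ≤ ∫ ω, M ω * (Real.log (M ω + δ) + 1) ∂μ := by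
    rw [← integral_add (hM.mul_log.integrable hm) (hM.integrable hm)]
    refine integral_mono_ae ((hM.mul_log.add hM).integrable hm) ((hM.mul hL1).integrable hm) ?_
    filter_upwards [hMI] with ω hω
    rcases hω.1.eq_or_lt with h0 | h0
    · rw [← h0]; simp
    · have := mul_le_mul_of_nonneg_left (Real.log_le_log h0 (show M ω ≤ M ω + δ by linarith)) h0.le
      linarith
  have hexp := expBound δ hδ
  rw [integral_add (hM.integrable hm) (integrable_const _), integral_const] at hexp
  simp only [probReal_univ, smul_eq_mul, one_mul] at hexp
  linarith

end InformationGain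

namespace GraphBandit

/-! ### Histories, observations and action indicators. -/

section Measurability

variable {Ω : Type*} {K : ℕ} (G : ℕ → Digraph (Fin K)) {Y : ℕ → Ω → RewardVec K}
  {A : ℕ → Ω → Fin K}

theorem measurable_observation (G : Digraph (Fin K)) :
    Measurable fun p : Fin K × RewardVec K => observation G p.1 p.2 := by
  classical
  unfold observation
  refine measurable_fst.prodMk (measurable_pi_lambda _ fun a => Measurable.ite ?_ ?_ ?_)
  · exact measurable_fst (MeasurableSet.of_discrete (s := {i | G.Adj i a}))
  · exact (measurable_pi_apply a).comp measurable_snd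
  · exact measurable_const

theorem history_le [MeasurableSpace Ω] (hY : ∀ t, Measurable (Y t)) (hA : ∀ t, Measurable (A t))
    (t : ℕ) : history G Y A t ≤ ‹MeasurableSpace Ω› :=
  Measurable.comap_le <| measurable_pi_lambda _ fun s =>
    (measurable_observation (G s)).comp ((hA s).prodMk (hY s))

theorem measurable_history_observation {s t : ℕ} (h : s < t) :
    Measurable[history G Y A t] fun ω => observation (G s) (A s ω) (Y s ω) :=
  (measurable_pi_apply (⟨s, h⟩ : Fin t)).comp
    (comap_measurable fun ω (r : Fin t) => observation (G r) (A r ω) (Y r ω))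

theorem history_mono {s t : ℕ} (h : s ≤ t) : history G Y A s ≤ history G Y A t := by
  refine measurable_iff_comap_le.1 ?_
  exact @measurable_pi_lambda _ _ _ (history G Y A t) _ _ fun r =>
    measurable_history_observation G (r.2.trans_le h)

/-- The indicator that the reward of action `a` is observed in round `t`. -/
noncomputable def observed (A : ℕ → Ω → Fin K) (t : ℕ) (a : Fin K) (ω : Ω) : ℝ :=
  open Classical in if (G t).Adj (A t ω) a then 1 else 0

theorem measurable_observed (t : ℕ) (a : Fin K) :
    Measurable[history G Y A (t + 1)] (observed G A t a) := by
  classical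
  exact (measurable_of_finite fun i => if (G t).Adj i a then (1 : ℝ) else 0).comp
    (measurable_fst.comp (measurable_history_observation G (Y := Y) t.lt_succ_self))

/-- An unobserved entry is recorded as 0, so the product is itself the recorded entry. -/
theorem measurable_observed_mul (t : ℕ) (a : Fin K) :
    Measurable[history G Y A (t + 1)] fun ω => observed G A t a ω * (Y t ω a : ℝ) := by
  have h : Measurable[history G Y A (t + 1)]
      fun ω => ((observation (G t) (A t ω) (Y t ω)).2 a : ℝ) :=
    measurable_subtype_coe.comp ((measurable_pi_apply a).comp
      (measurable_snd.comp (measurable_history_observation G t.lt_succ_self)))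
  convert h using 2 with ω
  simp only [observed, observation]
  split_ifs <;> simp

/-- The σ-algebra given which the action of round `t` is sampled. -/
@[reducible]
noncomputable def preAction (G : ℕ → Digraph (Fin K)) (pstar : Ω → ProbabilityMeasure (RewardVec K))
    (Y : ℕ → Ω → RewardVec K) (A : ℕ → Ω → Fin K) (t : ℕ) : MeasurableSpace Ω :=
  history G Y A t ⊔ MeasurableSpace.comap pstar inferInstance
    ⊔ MeasurableSpace.comap (fun ω s => Y s ω) inferInstance

theorem history_le_preAction {G : ℕ → Digraph (Fin K)}
    {pstar : Ω → ProbabilityMeasure (RewardVec K)} {t : ℕ} :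
    history G Y A t ≤ preAction G pstar Y A t :=
  le_sup_left.trans le_sup_left

theorem preAction_le [MeasurableSpace Ω] {μ : Measure Ω} {G : ℕ → Digraph (Fin K)}
    {pstar : Ω → ProbabilityMeasure (RewardVec K)} {Astar : Ω → Fin K} {t : ℕ}
    (hb : IsBayesianBandit μ pstar Astar Y) (hA : ∀ t, Measurable (A t)) :
    preAction G pstar Y A t ≤ ‹MeasurableSpace Ω› :=
  sup_le (sup_le (history_le G hb.measurable_reward hA t) hb.measurable_pstar.comap_le)
    (measurable_pi_lambda _ hb.measurable_reward).comap_le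

theorem measurable_Astar_preAction [MeasurableSpace Ω] {μ : Measure Ω} {G : ℕ → Digraph (Fin K)}
    {pstar : Ω → ProbabilityMeasure (RewardVec K)} {Astar : Ω → Fin K} {t : ℕ}
    (hb : IsBayesianBandit μ pstar Astar Y) :
    Measurable[preAction G pstar Y A t] Astar :=
  hb.measurable_Astar.mono (le_sup_right.trans le_sup_left) le_rfl

/-- The indicator that the action drawn by `B` is `a`. -/
noncomputable def isAction (B : Ω → Fin K) (a : Fin K) : Ω → ℝ :=
  (B ⁻¹' {a}).indicator fun _ => 1

theorem isAction_mem_Icc (B : Ω → Fin K) (a : Fin K) (ω : Ω) :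
    isAction B a ω ∈ Set.Icc (0 : ℝ) 1 := by
  by_cases h : ω ∈ B ⁻¹' {a} <;> simp [isAction, h]

theorem sum_isAction_mul (B : Ω → Fin K) (f : Fin K → ℝ) (ω : Ω) :
    ∑ a, isAction B a ω * f a = f (B ω) := by
  rw [Finset.sum_eq_single (B ω)]
  · simp [isAction]
  · intro b _ hb
    simp [isAction, hb.symm]
  · simp

/-- The sampling rule speaks of single actions; this form transfers it to observation events by
linearity. -/
theorem observed_eq_sum (t : ℕ) (a : Fin K) :
    open Classical in observed G A t a = ∑ j with (G t).Adj j a, isAction (A t) j := by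
  classical
  ext ω
  have := sum_isAction_mul (A t) (fun j => if (G t).Adj j a then (1 : ℝ) else 0) ω
  rw [Finset.sum_apply, Finset.sum_filter]
  simpa [observed] using this.symm

theorem reward_mem_Icc (Y : ℕ → Ω → RewardVec K) (t : ℕ) (a : Fin K) (ω : Ω) :
    (Y t ω a : ℝ) ∈ Set.Icc (0 : ℝ) 1 := (Y t ω a).2

end Measurability

/-! ### Information and regret of one round, and the entropy telescope. -/

section Rounds

variable {Ω : Type*} {m : MeasurableSpace Ω} [MeasurableSpace Ω] {μ : Measure Ω} {K : ℕ}
  {G : ℕ → Digraph (Fin K)} {pstar : Ω → ProbabilityMeasure (RewardVec K)} {Astar : Ω → Fin K}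
  {Y : ℕ → Ω → RewardVec K} {A : ℕ → Ω → Fin K} {T t : ℕ} {π : ℕ → Fin K → Ω → ℝ} {ε : ℝ}

theorem bddMeas_isAction {B : Ω → Fin K} (hB : Measurable[m] B)
    (a : Fin K) : BddMeas m μ (isAction B a) :=
  BddMeas.of_mem_Icc ((measurable_const.indicator
      (hB (measurableSet_singleton a))).stronglyMeasurable.aestronglyMeasurable)
    (Filter.Eventually.of_forall (isAction_mem_Icc B a))

/-- The conditional probability, under the sampling probabilities `π`, of observing the reward
of action `a` in round `t`. -/
noncomputable def observeProb (G : ℕ → Digraph (Fin K)) (π : ℕ → Fin K → Ω → ℝ) (t : ℕ)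
    (a : Fin K) (ω : Ω) : ℝ :=
  open Classical in ∑ j with (G t).Adj j a, π t j ω

theorem bddMeas_observeProb (hπ : ∀ a, BddMeas m μ (π t a)) (a : Fin K) :
    BddMeas m μ (observeProb G π t a) :=
  BddMeas.sum _ fun j _ => hπ j

theorem bddMeas_reward (a : Fin K) :
    BddMeas (preAction G pstar Y A t) μ fun ω => (Y t ω a : ℝ) := by
  refine BddMeas.of_mem_Icc ?_ (Filter.Eventually.of_forall (reward_mem_Icc Y t a))
  have h : Measurable[MeasurableSpace.comap (fun ω s => Y s ω) inferInstance]
      fun ω => (Y t ω a : ℝ) :=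
    measurable_subtype_coe.comp ((measurable_pi_apply a).comp
      ((measurable_pi_apply t).comp (comap_measurable (fun ω s => Y s ω))))
  have h' : Measurable[preAction G pstar Y A t] fun ω => (Y t ω a : ℝ) :=
    h.mono le_sup_right le_rfl
  exact h'.stronglyMeasurable.aestronglyMeasurable

variable [IsProbabilityMeasure μ]

theorem posteriorProb_mem_Icc (hb : IsBayesianBandit μ pstar Astar Y)
    (hA : ∀ t, Measurable (A t)) (a : Fin K) :
    ∀ᵐ ω ∂μ, posteriorProb μ G Astar Y A t a ω ∈ Set.Icc (0 : ℝ) 1 :=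
  condExp_mem_Icc (history_le G hb.measurable_reward hA t)
    (((bddMeas_isAction (measurable_Astar_preAction (G := G) (A := A) (t := t) hb) a).integrable
      (preAction_le hb hA)))
    (isAction_mem_Icc Astar a)

theorem bddMeas_posteriorProb (hb : IsBayesianBandit μ pstar Astar Y)
    (hA : ∀ t, Measurable (A t)) (a : Fin K) :
    BddMeas (history G Y A t) μ (posteriorProb μ G Astar Y A t a) :=
  BddMeas.of_mem_Icc stronglyMeasurable_condExp.aestronglyMeasurable
    (posteriorProb_mem_Icc hb hA a)

theorem bddMeas_tsuPolicy (hb : IsBayesianBandit μ pstar Astar Y)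
    (hA : ∀ t, Measurable (A t)) (a : Fin K) :
    BddMeas (history G Y A t) μ (tsuPolicy μ G Astar Y A ε t a) :=
  ((BddMeas.const _).mul (bddMeas_posteriorProb hb hA a)).add (BddMeas.const _)

/-- Fresh randomness: conditioning also on `pstar` and all rewards leaves the observation
probability unchanged. The information bound needs this. -/
theorem condExp_observed (hp : PlaysPolicy μ G pstar Y A T π) (ht : t < T) (a : Fin K) :
    μ[observed G A t a | preAction G pstar Y A t] =ᵐ[μ] observeProb G π t a := by
  classical
  rw [observed_eq_sum]
  refine (condExp_finsetSum (fun j _ =>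
    (bddMeas_isAction (hp.measurable_action t) j).integrable le_rfl) _).trans ?_
  have h : ∀ᵐ ω ∂μ, ∀ j, (μ[isAction (A t) j | preAction G pstar Y A t]) ω = π t j ω :=
    ae_all_iff.2 fun j => hp.sampling t ht j
  filter_upwards [h] with ω hω
  rw [Finset.sum_apply]
  exact Finset.sum_congr (by congr!) fun j _ => hω j

/-- The difference between the posterior mean reward of `a` in round `t` given that `a` is
optimal, and its posterior mean. -/
noncomputable def optimalityGap (μ : Measure Ω) (G : ℕ → Digraph (Fin K)) (Astar : Ω → Fin K)
    (Y : ℕ → Ω → RewardVec K) (A : ℕ → Ω → Fin K) (t : ℕ) (a : Fin K) : Ω → ℝ :=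
  condMeanGap μ (history G Y A t) (isAction Astar a) fun ω => (Y t ω a : ℝ)

theorem bddMeas_optimalityGap (hb : IsBayesianBandit μ pstar Astar Y)
    (hA : ∀ t, Measurable (A t)) (a : Fin K) :
    BddMeas (history G Y A t) μ (optimalityGap μ G Astar Y A t a) :=
  have hG := preAction_le (G := G) (t := t) hb hA
  bddMeas_condMeanGap (history_le G hb.measurable_reward hA t)
    ((bddMeas_isAction (measurable_Astar_preAction hb) a).mono hG) (isAction_mem_Icc Astar a)
    ((bddMeas_reward a).mono hG) (reward_mem_Icc Y t a)

/-- The information about the event `Astar = a` that is gained in one round. -/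
theorem integral_posteriorProb_mul_log_add_le (hb : IsBayesianBandit μ pstar Astar Y)
    (hp : PlaysPolicy μ G pstar Y A T π) (ht : t < T)
    (hπ : ∀ a, BddMeas (history G Y A t) μ (π t a)) (a : Fin K) :
    2 * ∫ ω, posteriorProb μ G Astar Y A t a ω * observeProb G π t a ω
        * optimalityGap μ G Astar Y A t a ω ^ 2 ∂μ
      + ∫ ω, posteriorProb μ G Astar Y A t a ω * Real.log (posteriorProb μ G Astar Y A t a ω) ∂μ
      ≤ ∫ ω, posteriorProb μ G Astar Y A (t + 1) a ω
          * Real.log (posteriorProb μ G Astar Y A (t + 1) a ω) ∂μ := by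
  have hb01 : ∀ ω, observed G A t a ω = 0 ∨ observed G A t a ω = 1 := by
    intro ω
    simp only [observed]
    split_ifs <;> simp
  have hb01' : ∀ ω, observed G A t a ω ∈ Set.Icc (0 : ℝ) 1 := fun ω => by
    rcases hb01 ω with h | h <;> simp [h]
  refine integral_mul_log_condExp_add_le (history_mono G t.le_succ)
    (history_le G hb.measurable_reward hp.measurable_action (t + 1)) history_le_preAction
    (preAction_le hb hp.measurable_action)
    (bddMeas_isAction (measurable_Astar_preAction hb) a) (isAction_mem_Icc Astar a)
    (bddMeas_reward a) (reward_mem_Icc Y t a) ?_ hb01 ?_ (bddMeas_observeProb hπ a)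
    (condExp_observed hp ht a)
  · exact BddMeas.of_mem_Icc (measurable_observed G t a).stronglyMeasurable.aestronglyMeasurable
      (Filter.Eventually.of_forall hb01')
  · exact BddMeas.of_mem_Icc (measurable_observed_mul G t a).stronglyMeasurable.aestronglyMeasurable
      (a := 0) (b := 1) (Filter.Eventually.of_forall fun ω =>
        ⟨mul_nonneg (hb01' ω).1 (reward_mem_Icc Y t a ω).1,
          mul_le_one₀ (hb01' ω).2 (reward_mem_Icc Y t a ω).1 (reward_mem_Icc Y t a ω).2⟩)

theorem posteriorProb_zero (hb : IsBayesianBandit μ pstar Astar Y) (a : Fin K) :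
    posteriorProb μ G Astar Y A 0 a = fun _ => prior μ Astar a := by
  have h : history G Y A 0 = ⊥ := by
    have : (fun ω (s : Fin 0) => observation (G s) (A s ω) (Y s ω)) = fun _ => default :=
      funext fun _ => Subsingleton.elim _ _
    rw [history, this, MeasurableSpace.comap_const]
  have hS : MeasurableSet (Astar ⁻¹' {a}) :=
    hb.measurable_pstar.comap_le _ (hb.measurable_Astar (measurableSet_singleton a))
  rw [posteriorProb, h, condExp_bot]
  simp [prior, integral_indicator hS]

/-- The information gained over all rounds is at most the entropy of the prior. -/
theorem two_mul_sum_information_le_shannonEntropy (hb : IsBayesianBandit μ pstar Astar Y)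
    (hp : PlaysPolicy μ G pstar Y A T π)
    (hπ : ∀ t a, BddMeas (history G Y A t) μ (π t a)) :
    2 * ∑ t ∈ Finset.range T, ∑ a, ∫ ω, posteriorProb μ G Astar Y A t a ω
        * observeProb G π t a ω * optimalityGap μ G Astar Y A t a ω ^ 2 ∂μ
      ≤ shannonEntropy (prior μ Astar) := by
  let Φ : ℕ → ℝ := fun t => ∑ a, ∫ ω, posteriorProb μ G Astar Y A t a ω
    * Real.log (posteriorProb μ G Astar Y A t a ω) ∂μ
  have step : ∀ t ∈ Finset.range T, 2 * ∑ a, ∫ ω, posteriorProb μ G Astar Y A t a ω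
        * observeProb G π t a ω * optimalityGap μ G Astar Y A t a ω ^ 2 ∂μ
      ≤ Φ (t + 1) - Φ t := by
    intro t ht
    rw [le_sub_iff_add_le, Finset.mul_sum, ← Finset.sum_add_distrib]
    exact Finset.sum_le_sum fun a _ =>
      integral_posteriorProb_mul_log_add_le hb hp (Finset.mem_range.1 ht) (hπ t) a
  have tele := Finset.sum_le_sum step
  rw [← Finset.mul_sum, Finset.sum_range_sub] at tele
  have hT : Φ T ≤ 0 := Finset.sum_nonpos fun a _ => by
    refine integral_nonpos_of_ae ?_
    filter_upwards [posteriorProb_mem_Icc hb hp.measurable_action a] with ω hω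
    exact Real.mul_log_nonpos hω.1 hω.2
  have h0 : Φ 0 = -shannonEntropy (prior μ Astar) := by
    simp [Φ, posteriorProb_zero hb, shannonEntropy]
  linarith

/-- The regret of one round in terms of the gaps of the actions. -/
theorem integral_round_regret_le (hb : IsBayesianBandit μ pstar Astar Y)
    (hε0 : 0 ≤ ε)
    (hp : PlaysPolicy μ G pstar Y A T (tsuPolicy μ G Astar Y A ε)) (ht : t < T) :
    ∫ ω, ((Y t ω (Astar ω) : ℝ) - (Y t ω (A t ω) : ℝ)) ∂μ
      ≤ ε + ∑ a, ∫ ω, (1 - ε) * posteriorProb μ G Astar Y A t a ω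
          * optimalityGap μ G Astar Y A t a ω ∂μ := by
  have hA := hp.measurable_action
  have hm := history_le G hb.measurable_reward hA t
  have hG := preAction_le (G := G) (t := t) hb hA
  have hy : ∀ a, BddMeas (preAction G pstar Y A t) μ (fun ω => (Y t ω a : ℝ)) := bddMeas_reward
  have hy0 := fun a => (hy a).mono hG
  have hs0 := fun a =>
    (bddMeas_isAction (measurable_Astar_preAction (G := G) (A := A) (t := t) hb) a).mono hG (μ := μ)
  have hb0 := fun a => bddMeas_isAction (μ := μ) (hA t) a
  have hsy := fun a => ((hs0 a).mul (hy0 a)).integrable le_rfl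
  have hby := fun a => ((hb0 a).mul (hy0 a)).integrable le_rfl
  have hπ := fun a => bddMeas_tsuPolicy (G := G) (t := t) (ε := ε) hb hA a
  have hM := fun a => bddMeas_posteriorProb (G := G) (t := t) hb hA a
  have hd := fun a => bddMeas_optimalityGap (G := G) (t := t) hb hA a
  have e1 : ∀ ω, (Y t ω (Astar ω) : ℝ) = ∑ a, isAction Astar a ω * (Y t ω a : ℝ) := fun ω =>
    (sum_isAction_mul Astar (fun a => (Y t ω a : ℝ)) ω).symm
  have e2 : ∀ ω, (Y t ω (A t ω) : ℝ) = ∑ a, isAction (A t) a ω * (Y t ω a : ℝ) := fun ω =>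
    (sum_isAction_mul (A t) (fun a => (Y t ω a : ℝ)) ω).symm
  -- Only the share `ε` of the optimal reward is bounded this crudely; the share `1 - ε` goes into
  -- the gaps.
  have hopt : ∑ a, ∫ ω, isAction Astar a ω * (Y t ω a : ℝ) ∂μ ≤ 1 := by
    rw [← integral_finsetSum _ fun a _ => hsy a]
    have h : ∫ ω, ∑ a, isAction Astar a ω * (Y t ω a : ℝ) ∂μ ≤ ∫ _, (1 : ℝ) ∂μ := by
      refine integral_mono (integrable_finsetSum _ fun a _ => hsy a) (integrable_const _)
        fun ω => ?_
      rw [← e1]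
      exact (reward_mem_Icc Y t _ ω).2
    simpa using h
  -- Two conditionings: given `preAction` the indicator becomes the policy, which is
  -- history-measurable, so the reward can then be averaged given the history.
  have hplay : ∀ a, ∫ ω, isAction (A t) a ω * (Y t ω a : ℝ) ∂μ
      = ∫ ω, (μ[fun ω => (Y t ω a : ℝ) | history G Y A t]) ω
          * tsuPolicy μ G Astar Y A ε t a ω ∂μ := by
    intro a
    rw [← BddMeas.integral_condExp_mul hG ((hb0 a).integrable le_rfl) (hy a),
      BddMeas.integral_condExp_mul hm ((hy0 a).integrable le_rfl) (hπ a)]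
    refine integral_congr_ae ?_
    filter_upwards [hp.sampling t ht a] with ω hω
    rw [mul_comm]
    exact congrArg _ hω
  have key : ∀ a, (1 - ε) * ∫ ω, isAction Astar a ω * (Y t ω a : ℝ) ∂μ
      - ∫ ω, isAction (A t) a ω * (Y t ω a : ℝ) ∂μ
      ≤ ∫ ω, (1 - ε) * posteriorProb μ G Astar Y A t a ω
          * optimalityGap μ G Astar Y A t a ω ∂μ := by
    intro a
    have hh := BddMeas.condExp_of_mem_Icc hm ((hy0 a).integrable le_rfl) (reward_mem_Icc Y t a)
    rw [hplay, ← integral_condExp hm (f := fun ω => isAction Astar a ω * (Y t ω a : ℝ)),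
      ← integral_const_mul, ← integral_sub (integrable_condExp.const_mul _)
        ((hh.mul (hπ a)).integrable hm)]
    refine integral_mono_ae ((integrable_condExp.const_mul _).sub ((hh.mul (hπ a)).integrable hm))
      ((((BddMeas.const (1 - ε)).mul (hM a)).mul (hd a)).integrable hm) ?_
    filter_upwards [condExp_mul_condMeanGap (m := history G Y A t) (hs0 a)
      (isAction_mem_Icc Astar a) (hy0 a) (reward_mem_Icc Y t a),
      condExp_mem_Icc hm ((hy0 a).integrable le_rfl) (reward_mem_Icc Y t a)] with ω hω hhω
    -- The reward earned by uniform exploration is discarded.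
    have hnn : 0 ≤ (μ[fun ω => (Y t ω a : ℝ) | history G Y A t]) ω * (ε / K) :=
      mul_nonneg hhω.1 (by positivity)
    change (μ[isAction Astar a | history G Y A t]) ω * optimalityGap μ G Astar Y A t a ω = _ at hω
    change _ ≤ (1 - ε) * (μ[isAction Astar a | history G Y A t]) ω
      * optimalityGap μ G Astar Y A t a ω
    have hπω : tsuPolicy μ G Astar Y A ε t a ω
      = (1 - ε) * (μ[isAction Astar a | history G Y A t]) ω + ε / K := rfl
    simp only [hπω]
    linear_combination hnn - (1 - ε) * hω
  have hsum := Finset.sum_le_sum fun a (_ : a ∈ Finset.univ) => key a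
  rw [Finset.sum_sub_distrib, ← Finset.mul_sum] at hsum
  simp_rw [e1, e2]
  rw [integral_sub (integrable_finsetSum _ fun a _ => hsy a)
    (integrable_finsetSum _ fun a _ => hby a), integral_finsetSum _ fun a _ => hsy a,
    integral_finsetSum _ fun a _ => hby a]
  have := mul_le_mul_of_nonneg_left hopt hε0
  linarith

end Rounds

/-! ### Balancing gaps against information, and the final bound. -/

/-- A gap is controlled by its squared size weighted with the probability `q` of observing it
and the inverse of that probability. -/
theorem mul_gap_le {p M r q d c : ℝ} (hp : 0 ≤ p) (hpM : p ≤ M) (hpr : p ≤ r) (hrq : r ≤ q)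
    (hc : 0 < c) : p * d ≤ c / 2 * (r / q) + 1 / (2 * c) * (M * q * d ^ 2) := by
  -- If `q = 0` then `p = 0`, and both sides vanish under `r / 0 = 0`.
  rcases (hp.trans (hpr.trans hrq)).eq_or_lt with h | hq
  · have : p = 0 := le_antisymm (h ▸ hpr.trans hrq) hp
    simp [this, ← h]
  · have h1 : p * d ≤ c / 2 * (p / q) + 1 / (2 * c) * (p * q * d ^ 2) := by
      have : 0 ≤ p / (2 * c * q) * (c - q * d) ^ 2 := by positivity
      have e : c / 2 * (p / q) + 1 / (2 * c) * (p * q * d ^ 2) - p * d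
          = p / (2 * c * q) * (c - q * d) ^ 2 := by field_simp; ring
      linarith
    have h2 : c / 2 * (p / q) ≤ c / 2 * (r / q) := by gcongr
    have h3 : 1 / (2 * c) * (p * q * d ^ 2) ≤ 1 / (2 * c) * (M * q * d ^ 2) := by gcongr
    linarith

/-- The Bayesian regret bound for Thompson sampling mixed with uniform exploration. -/
theorem bayesRegret_tsu_le {Ω : Type*} [MeasurableSpace Ω] (μ : Measure Ω) [IsProbabilityMeasure μ]
    {K : ℕ} (G : ℕ → Digraph (Fin K)) (hG : ∀ t i, (G t).Adj i i)
    (pstar : Ω → ProbabilityMeasure (RewardVec K)) (Astar : Ω → Fin K)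
    (Y : ℕ → Ω → RewardVec K) (A : ℕ → Ω → Fin K)
    (hbandit : IsBayesianBandit μ pstar Astar Y)
    {ε : ℝ} (hε0 : 0 ≤ ε) (hε1 : ε ≤ 1) {T : ℕ}
    (hplay : PlaysPolicy μ G pstar Y A T
      (tsuPolicy μ G Astar Y A ε)) :
    bayesRegret μ Astar Y A T ≤
      ε * T + Real.sqrt (1 / 2 *
        (∑ t ∈ Finset.range T,
          ∫ ω, graphQ (G t)
            (fun a => tsuPolicy μ G Astar Y A ε t a ω) ∂μ) *
        shannonEntropy (prior μ Astar)) := by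
  have hA := hplay.measurable_action
  have hm := fun t => history_le G hbandit.measurable_reward hA t
  let π := tsuPolicy μ G Astar Y A ε
  let M := posteriorProb μ G Astar Y A
  let q := observeProb G π
  let d := optimalityGap μ G Astar Y A
  have hπ : ∀ t a, BddMeas (history G Y A t) μ (π t a) := fun t a =>
    bddMeas_tsuPolicy hbandit hA a
  have hM : ∀ t a, BddMeas (history G Y A t) μ (M t a) := fun t a =>
    bddMeas_posteriorProb hbandit hA a
  have hd : ∀ t a, BddMeas (history G Y A t) μ (d t a) := fun t a =>
    bddMeas_optimalityGap hbandit hA a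
  have hq : ∀ t a, BddMeas (history G Y A t) μ (q t a) := fun t a => bddMeas_observeProb (hπ t) a
  have hM01 : ∀ t, ∀ᵐ ω ∂μ, ∀ a, M t a ω ∈ Set.Icc (0 : ℝ) 1 := fun t =>
    ae_all_iff.2 fun a => posteriorProb_mem_Icc hbandit hA a
  have hMπ : ∀ t a ω, (1 - ε) * M t a ω ≤ π t a ω := fun t a ω =>
    le_add_of_nonneg_right (by positivity)
  have hπq : ∀ t, ∀ᵐ ω ∂μ, ∀ a, 0 ≤ π t a ω ∧ π t a ω ≤ q t a ω := by
    intro t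
    filter_upwards [hM01 t] with ω hω
    have h0 : ∀ a, 0 ≤ π t a ω := fun a =>
      (mul_nonneg (sub_nonneg.2 hε1) (hω a).1).trans (hMπ t a ω)
    refine fun a => ⟨h0 a, ?_⟩
    -- The self-loop at `a` makes `π t a` one of the summands of `q t a`.
    exact Finset.single_le_sum (f := fun j => π t j ω) (fun j _ => h0 j) (by simp [hG])
  have hr01 : ∀ t a, ∀ᵐ ω ∂μ, π t a ω / q t a ω ∈ Set.Icc (0 : ℝ) 1 := by
    intro t a
    filter_upwards [hπq t] with ω hω
    exact ⟨div_nonneg (hω a).1 ((hω a).1.trans (hω a).2),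
      div_le_one_of_le₀ (hω a).2 ((hω a).1.trans (hω a).2)⟩
  have hr : ∀ t a, BddMeas (history G Y A t) μ (fun ω => π t a ω / q t a ω) := fun t a =>
    (hπ t a).div_of_mem_Icc (hq t a) (hr01 t a)
  have hI : ∀ t a, BddMeas (history G Y A t) μ (fun ω => M t a ω * q t a ω * d t a ω ^ 2) := by
    intro t a
    simpa only [pow_two] using ((hM t a).mul (hq t a)).mul ((hd t a).mul (hd t a))
  have hQ : ∀ t, ∫ ω, graphQ (G t) (fun a => π t a ω) ∂μ = ∑ a, ∫ ω, π t a ω / q t a ω ∂μ :=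
    fun t => integral_finsetSum _ fun a _ => (hr t a).integrable (hm t)
  have hround : ∀ c > 0, ∀ t ∈ Finset.range T,
      ∫ ω, ((Y t ω (Astar ω) : ℝ) - (Y t ω (A t ω) : ℝ)) ∂μ
      ≤ ε + (c / 2 * ∫ ω, graphQ (G t) (fun a => π t a ω) ∂μ
        + 1 / (2 * c) * ∑ a, ∫ ω, M t a ω * q t a ω * d t a ω ^ 2 ∂μ) := by
    intro c hc t ht
    refine (integral_round_regret_le hbandit hε0 hplay (Finset.mem_range.1 ht)).trans ?_
    rw [hQ, Finset.mul_sum, Finset.mul_sum, ← Finset.sum_add_distrib]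
    refine add_le_add_right (Finset.sum_le_sum fun a _ => ?_) _
    rw [← integral_const_mul, ← integral_const_mul,
      ← integral_add (((hr t a).integrable (hm t)).const_mul _)
        (((hI t a).integrable (hm t)).const_mul _)]
    refine integral_mono_ae
      ((((BddMeas.const (1 - ε)).mul (hM t a)).mul (hd t a)).integrable (hm t))
      ((((hr t a).integrable (hm t)).const_mul _).add
        (((hI t a).integrable (hm t)).const_mul _)) ?_
    filter_upwards [hM01 t, hπq t] with ω h1 h2
    exact mul_gap_le (mul_nonneg (sub_nonneg.2 hε1) (h1 a).1)
      (mul_le_of_le_one_left (h1 a).1 (by linarith)) (hMπ t a ω) (h2 a).2 hc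
  have hinfo := two_mul_sum_information_le_shannonEntropy hbandit hplay hπ
  have hi0 : 0 ≤ ∑ t ∈ Finset.range T, ∑ a, ∫ ω, M t a ω * q t a ω * d t a ω ^ 2 ∂μ := by
    refine Finset.sum_nonneg fun t _ => Finset.sum_nonneg fun a _ => integral_nonneg_of_ae ?_
    filter_upwards [hM01 t, hπq t] with ω h1 h2
    exact mul_nonneg (mul_nonneg (h1 a).1 ((h2 a).1.trans (h2 a).2)) (sq_nonneg _)
  have hQ0 : 0 ≤ ∑ t ∈ Finset.range T, ∫ ω, graphQ (G t) (fun a => π t a ω) ∂μ := by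
    refine Finset.sum_nonneg fun t _ => ?_
    rw [hQ]
    refine Finset.sum_nonneg fun a _ => integral_nonneg_of_ae ?_
    filter_upwards [hr01 t a] with ω hω using hω.1
  have hreg : bayesRegret μ Astar Y A T
      = ∑ t ∈ Finset.range T, ∫ ω, ((Y t ω (Astar ω) : ℝ) - (Y t ω (A t ω) : ℝ)) ∂μ := by
    refine integral_finsetSum _ fun t _ => ?_
    have hmeas : ∀ B : Ω → Fin K, Measurable B → Integrable (fun ω => (Y t ω (B ω) : ℝ)) μ := by
      intro B hB
      simp_rw [← fun ω => sum_isAction_mul B (fun a => (Y t ω a : ℝ)) ω]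
      exact integrable_finsetSum _ fun a _ => ((bddMeas_isAction hB a).mul
        ((bddMeas_reward (G := G) (A := A) (t := t) (pstar := pstar) a).mono
          (preAction_le hbandit hA))).integrable le_rfl
    exact (hmeas _ (hbandit.measurable_Astar.mono hbandit.measurable_pstar.comap_le le_rfl)).sub
      (hmeas _ (hA t))
  rw [← sub_le_iff_le_add', mul_comm (1 / 2 : ℝ), mul_assoc]
  -- One weight `c` serves all rounds and actions; the second factor is half the prior entropy,
  -- which bounds the total of the squared gaps.
  refine Real.le_sqrt_mul_of_forall_pos hQ0 (by linarith) fun c hc => ?_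
  have hsum := Finset.sum_le_sum (hround c hc)
  rw [← hreg, Finset.sum_add_distrib, Finset.sum_add_distrib, ← Finset.mul_sum, ← Finset.mul_sum,
    Finset.sum_const, Finset.card_range, nsmul_eq_mul] at hsum
  have hfin := mul_le_mul_of_nonneg_left hinfo (show 0 ≤ 1 / (2 * c) by positivity)
  linarith

end GraphBandit

theorem mainTheorem4 {Ω : Type*} [MeasurableSpace Ω] (μ : Measure Ω) [IsProbabilityMeasure μ]
    {K : ℕ} (G : ℕ → Digraph (Fin K)) (hG : ∀ t i, (G t).Adj i i)
    (pstar : Ω → ProbabilityMeasure (GraphBandit.RewardVec K)) (Astar : Ω → Fin K)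
    (Y : ℕ → Ω → GraphBandit.RewardVec K) (A : ℕ → Ω → Fin K)
    (hbandit : GraphBandit.IsBayesianBandit μ pstar Astar Y)
    (ε : ℝ) (hε0 : 0 ≤ ε) (hε1 : ε ≤ 1) (T : ℕ)
    (hplay : GraphBandit.PlaysPolicy μ G pstar Y A T
      (GraphBandit.tsuPolicy μ G Astar Y A ε)) :
    GraphBandit.bayesRegret μ Astar Y A T ≤
      ε * T + Real.sqrt (1 / 2 *
        (∑ t ∈ Finset.range T,
          ∫ ω, GraphBandit.graphQ (G t)
            (fun a => GraphBandit.tsuPolicy μ G Astar Y A ε t a ω) ∂μ) *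
        GraphBandit.shannonEntropy (GraphBandit.prior μ Astar)) :=
  GraphBandit.bayesRegret_tsu_le μ G hG pstar Astar Y A hbandit hε0 hε1 hplay
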